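/- **Setting.** A Fisher market has $n$ agents with budgets $w_i>0$, $m$ divisible goods with capacities $\bar s_j\ge 0$, and homogeneous linear constraints: the bundle of agent $i$ must lie in $\mathcal X_i=\{x\in\mathbb R^m_{\ge 0}: A^{(i)}x\le 0\}$ for a given real matrix $A^{(i)}$. The utilities $u_i$ are homogeneous of degree one on $\mathcal X_i$ and strictly concave in the sense appropriate to such functions: $u_i$ is concave on $\mathcal X_i$ and $u_i(ax+bz)>a\,u_i(x)+b\,u_i(z)$ for $a,b>0$, $a+b=1$, whenever $u_i(x),u_i(z)>0$ and $x,z$ do not lie on a common ray. A vector $p\in\mathbb R^m$ is an equilibrium price vector if there are bundles $x_i$, each maximizing $u_i$ over $\{x\in\mathcal X_i: p^Tx\le w_i\}$, with $\sum_i x_{ij}=\bar s_j$ for all $j$ and $p^Tx_i=w_i$ for all $i$. Consider the program: maximize $f(x)=\sum_i w_i\log u_i(x_i)$ over $x_i\in\mathcal X_i$, $y_i\in\mathbb R^m$, subject to $\sum_i y_{ij}=\bar s_j$ for all $j$ (multipliers $p$) and $x_i=y_i$ for all $i$ (multipliers $\tilde p_i$), where $\log 0=-\infty$. Its dual objective is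 $$D(p,\tilde p)=\sup_{x_i\in\mathcal X_i,\;y}\Big\{f(x)-\sum_j p_j\Big(\sum_i y_{ij}-\bar s_j\Big)-\sum_{i,j}\tilde p_{ij}(x_{ij}-y_{ij})\Big\}\in(-\infty,+\infty].$$ Let $B$ be the coefficient matrix of $x$ in these constraints and $\rho(B^TB)$ the spectral radius of $B^TB$. The alternating minimization algorithm (AMA) with step size $\beta>0$ and arbitrary initial $p^{(0)},\tilde p^{(0)}$ computes, for $k=0,1,2,\dots$, $$x_i^{(k+1)}\in\operatorname*{arg\,max}_{x_i\in\mathcal X_i}\Big\{w_i\log u_i(x_i)-\sum_j\tilde p^{(k)}_{ij}x_{ij}\Big\},$$ $$y^{(k+1)}\in\operatorname*{arg\,max}_{y}\Big\{\sum_{i,j}\tilde p^{(k)}_{ij}y_{ij}-\tfrac\beta2\sum_{i,j}(x^{(k+1)}_{ij}-y_{ij})^2-\sum_jp^{(k)}_j\Big(\sum_iy_{ij}-\bar s_j\Big)-\tfrac\beta2\sum_j\Big(\sum_iy_{ij}-\bar s_j\Big)^2\Big\},$$ $$p^{(k+1)}=p^{(k)}+\beta\Big(\sum_iy^{(k+1)}_i-\bar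 s\Big),\qquad \tilde p^{(k+1)}_i=\tilde p^{(k)}_i+\beta\,(x^{(k+1)}_i-y^{(k+1)}_i).$$ **Theorem (convergence of AMA).** Let $(p^{(k)},\tilde p^{(k)},x^{(k)},y^{(k)})$ be iterates of AMA with $p^{(k)}_j>0$ for all $k,j$. Let $\sigma_f$ be a strong concavity modulus of $f$ (for the Euclidean norm on $\mathbb R^{nm}$) on some convex set of allocations with $x_i\in\mathcal X_i$, $u_i(x_i)>0$ for all $i$, that contains $x^{(k)}$ for all $k\ge1$, and suppose $0<\beta<2\sigma_f/\rho(B^TB)$. If an equilibrium price vector exists, then $p^{(k)}$ converges to an equilibrium price vector $p^*$, and the convergence has rate $O(1/k)$ in the dual objective: $p^*$ (with $\tilde p_i=p^*$ for all $i$) minimizes $D$, the minimum $D^*$ is finite, and there is a constant $C$ with $$D(p^{(k)},\tilde p^{(k)})\le D^*+\frac Ck\qquad\text{for all }k\ge 1.$$ **Corollary (classical Fisher markets).** Under the same hypotheses, except that the existence of an equilibrium is not assumed, the same conclusion holds if there are no linear constraints ($\mathcal X_i=\mathbb R^m_{\ge0}$ for all $i$), provided $\bar s_j>0$ for all $j$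 and the utilities are continuous and non-negative on $\mathbb R^m_{\ge0}$. -/

import Mathlib

open Filter Topology
open scoped Matrix

noncomputable section

/-- A Fisher market with `n` agents, `m` divisible goods and homogeneous linear constraints
`A i *ᵥ x ≤ 0` on the bundle of agent `i`. -/
structure FisherMarket (n m : ℕ) where
  budget : Fin n → ℝ
  budget_pos : ∀ i, 0 < budget i
  capacity : Fin m → ℝ
  capacity_nonneg : ∀ j, 0 ≤ capacity j
  utility : Fin n → (Fin m → ℝ) → ℝ
  numConstraints : Fin n → ℕ
  A : (i : Fin n) → Matrix (Fin (numConstraints i)) (Fin m) ℝ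

namespace FisherMarket

variable {n m : ℕ}

/-- The set `𝒳ᵢ` of bundles `x ≥ 0` with `A i *ᵥ x ≤ 0`. -/
def feasible (M : FisherMarket n m) (i : Fin n) : Set (Fin m → ℝ) :=
  {x | (∀ j, 0 ≤ x j) ∧ ∀ t, (M.A i *ᵥ x) t ≤ 0}

/-- A classical Fisher market: no linear constraints besides `x ≥ 0`. -/
def IsClassical (M : FisherMarket n m) : Prop := ∀ i, M.numConstraints i = 0

/-- Homogeneity of degree one on `𝒳ᵢ`. -/
def HomogeneousUtilities (M : FisherMarket n m) : Prop :=
  ∀ i, ∀ x ∈ M.feasible i, ∀ t : ℝ, 0 < t → M.utility i (t • x) = t * M.utility i x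

/-- Strict concavity of the utilities, as it is meant for functions homogeneous of degree one:
such a function is linear along rays from the origin, so strictness is required between bundles
of positive utility that do not lie on a common ray. (For a concave function homogeneous of degree
one this says that `log ∘ u` is strictly concave where `u > 0`.) -/
def StrictlyConcaveUtilities (M : FisherMarket n m) : Prop :=
  ∀ i, ConcaveOn ℝ (M.feasible i) (M.utility i) ∧
    ∀ x ∈ M.feasible i, ∀ z ∈ M.feasible i, 0 < M.utility i x → 0 < M.utility i z →
      ¬ SameRay ℝ x z → ∀ a b : ℝ, 0 < a → 0 < b → a + b = 1 →
        a * M.utility i x + b * M.utility i z < M.utility i (a • x + b • z)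

/-- `x` is an optimal solution of the individual optimization problem of agent `i` at prices `p`:
maximize `u_i` over `𝒳ᵢ` subject to the budget constraint `p ⬝ᵥ x ≤ w_i`. -/
def IsOptimalBundle (M : FisherMarket n m) (p : Fin m → ℝ) (i : Fin n) (x : Fin m → ℝ) : Prop :=
  x ∈ M.feasible i ∧ p ⬝ᵥ x ≤ M.budget i ∧
    ∀ z ∈ M.feasible i, p ⬝ᵥ z ≤ M.budget i → M.utility i z ≤ M.utility i x

/-- Equilibrium price vector: every agent gets an optimal bundle, all goods are sold to capacity
and all budgets are completely used. -/
def IsEquilibriumPrice (M : FisherMarket n m) (p : Fin m → ℝ) : Prop :=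
  ∃ x : Fin n → Fin m → ℝ, (∀ i, M.IsOptimalBundle p i (x i)) ∧
    (∀ j, ∑ i, x i j = M.capacity j) ∧ ∀ i, p ⬝ᵥ x i = M.budget i

/-- The bundles of `𝒳ᵢ` at which `log u_i` is finite. -/
def domain (M : FisherMarket n m) (i : Fin n) : Set (Fin m → ℝ) :=
  {x | x ∈ M.feasible i ∧ 0 < M.utility i x}

/-- `x` is a maximizer over `𝒳ᵢ` of `w_i log u_i(x) - q ⬝ᵥ x` (with `log 0 = -∞`). -/
def IsDemand (M : FisherMarket n m) (q : Fin m → ℝ) (i : Fin n) (x : Fin m → ℝ) : Prop :=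
  x ∈ M.domain i ∧ ∀ z ∈ M.domain i,
    M.budget i * Real.log (M.utility i z) - q ⬝ᵥ z ≤
      M.budget i * Real.log (M.utility i x) - q ⬝ᵥ x

/-- The objective of the `y`-update, given `p`, the individual prices `q` and the demands `x`. -/
def yObjective (M : FisherMarket n m) (β : ℝ) (p : Fin m → ℝ) (q x y : Fin n → Fin m → ℝ) : ℝ :=
  ∑ i, ∑ j, q i j * y i j - β / 2 * ∑ i, ∑ j, (x i j - y i j) ^ 2
    - ∑ j, p j * (∑ i, y i j - M.capacity j)
    - β / 2 * ∑ j, (∑ i, y i j - M.capacity j) ^ 2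

/-- `p` (market prices), `q` (individual prices), `x`, `y` are the iterates of the two-block
alternating minimization algorithm with step size `β`, from arbitrary initial `p 0`, `q 0`, `y 0`.
(`x 0` plays no role.) -/
structure IsAMARun (M : FisherMarket n m) (β : ℝ) (p : ℕ → Fin m → ℝ)
    (q x y : ℕ → Fin n → Fin m → ℝ) : Prop where
  x_step : ∀ k i, M.IsDemand (q k i) i (x (k + 1) i)
  y_step : ∀ k, ∀ z : Fin n → Fin m → ℝ,
    M.yObjective β (p k) (q k) (x (k + 1)) z ≤ M.yObjective β (p k) (q k) (x (k + 1)) (y (k + 1))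
  p_step : ∀ k j, p (k + 1) j = p k j + β * (∑ i, y (k + 1) i j - M.capacity j)
  q_step : ∀ k i j, q (k + 1) i j = q k i j + β * (x (k + 1) i j - y (k + 1) i j)

/-- The Eisenberg–Gale objective `f(x) = ∑ w_i log u_i(x_i)` on stacked allocations, which carry
the Euclidean norm. -/
def objective (M : FisherMarket n m) (x : EuclideanSpace ℝ (Fin n × Fin m)) : ℝ :=
  ∑ i, M.budget i * Real.log (M.utility i (fun j => x (i, j)))

/-- An allocation as one vector of length `n * m`. -/
def stack (x : Fin n → Fin m → ℝ) : EuclideanSpace ℝ (Fin n × Fin m) :=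
  WithLp.toLp 2 (fun ij => x ij.1 ij.2)

/-- The coefficient matrix of `x` in the constraints `∑ i, y i j = s j` (rows `Sum.inl j`) and
`x i j - y i j = 0` (rows `Sum.inr (i, j)`). -/
def xCoeff (n m : ℕ) : Matrix (Fin m ⊕ (Fin n × Fin m)) (Fin n × Fin m) ℝ :=
  Matrix.fromRows 0 1

/-- The spectral radius `ρ(Bᵀ B)` for the coefficient matrix `B` of `x`. -/
def rhoBtB (n m : ℕ) : ℝ :=
  (spectralRadius ℝ ((xCoeff n m)ᵀ * xCoeff n m)).toReal

/-- The Lagrangian of the problem: maximize `∑ w_i log u_i(x_i)` over `x_i ∈ 𝒳ᵢ` and `y` subject to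
`∑ i, y i j = s j` (multipliers `p`) and `x i = y i` (multipliers `q i`). -/
def lagrangian (M : FisherMarket n m) (p : Fin m → ℝ) (q x y : Fin n → Fin m → ℝ) : ℝ :=
  ∑ i, M.budget i * Real.log (M.utility i (x i))
    - ∑ j, p j * (∑ i, y i j - M.capacity j) - ∑ i, ∑ j, q i j * (x i j - y i j)

/-- The dual objective: the supremum of the Lagrangian, possibly `+∞`. -/
def dual (M : FisherMarket n m) (p : Fin m → ℝ) (q : Fin n → Fin m → ℝ) : EReal :=
  ⨆ x ∈ {x : Fin n → Fin m → ℝ | ∀ i, x i ∈ M.domain i}, ⨆ y : Fin n → Fin m → ℝ,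
    (M.lagrangian p q x y : EReal)

/-- The prices converge to an equilibrium price vector `pStar`, which is an optimal dual solution
with a finite value `v`, and the dual objective converges to `v` at rate `O(1/k)`. -/
def ConvergesToEquilibrium (M : FisherMarket n m) (p : ℕ → Fin m → ℝ)
    (q : ℕ → Fin n → Fin m → ℝ) : Prop :=
  ∃ pStar : Fin m → ℝ, M.IsEquilibriumPrice pStar ∧ Tendsto p atTop (𝓝 pStar) ∧
    ∃ v : ℝ, M.dual pStar (fun _ => pStar) = (v : EReal) ∧
      (∀ p' q', (v : EReal) ≤ M.dual p' q') ∧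
      ∃ C : ℝ, ∀ k : ℕ, 1 ≤ k → M.dual (p k) (q k) ≤ ((v + C / k : ℝ) : EReal)

end FisherMarket

end

/-! From its second iteration on, AMA is gradient descent on the dual at common prices. Stationarity
of the `y`-update forces every individual price to equal the market price (`IsAMARun.price_eq`), and
eliminating `y` leaves a step of length `β / (n + 1)` against the excess supply
(`IsAMARun.gradient_step`).

At common prices the dual is a supremum of functions affine in `p` whose slopes are excess supplies,
so the excess supply at the demands is a subgradient. Strong concavity of `f` makes the dual behave
along the run like a smooth function with constant `n / σ`. The step is below `2σ / n`, so the
values drop by a multiple of the squared gradient (`sufficient_decrease`), and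
`gradientDescent_converges` gives the limit and the rate.

Homogeneity identifies demands with optimal bundles that exhaust the budget, so an equilibrium price
minimizes the dual, and the equilibrium allocation is still a demand at the limit price. In the
classical case the run itself yields an equilibrium: prices stay bounded, excess supply vanishes,
and a cluster point of prices and demands clears the market. -/

/-! ### Descent sequences and strong concavity -/

/-- Gradient descent with sufficient decrease: if the values `φ k` and gradients `g k` at the
iterates satisfy the subgradient inequality among the iterates and at one minimizer, the iterates
converge and the values converge to the minimum at rate `O(1/k)`. -/
theorem gradientDescent_converges {E : Type*} [NormedAddCommGroup E] [InnerProductSpace ℝ E]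
    [FiniteDimensional ℝ E] (p g : ℕ → E) (φ : ℕ → ℝ) (α c v : ℝ) (hα : 0 < α) (hc : 0 < c)
    (z₀ : E) (hstep : ∀ k, p (k + 1) = p k - α • g k)
    (hdec : ∀ k, φ (k + 1) ≤ φ k - c * ‖g k‖ ^ 2) (hlow : ∀ k, v ≤ φ k)
    (hsub : ∀ k l, φ k + inner ℝ (g k) (p l - p k) ≤ φ l)
    (hz₀ : ∀ k, φ k + inner ℝ (g k) (z₀ - p k) ≤ v) :
    ∃ z, Tendsto p atTop (𝓝 z) ∧ Tendsto φ atTop (𝓝 v) ∧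
      ∃ C : ℝ, 0 ≤ C ∧ ∀ k : ℕ, (k + 1) * (φ k - v) ≤ C := by
  have hanti : Antitone φ := antitone_nat_of_succ_le fun k => by
    have := hdec k
    have : 0 ≤ c * ‖g k‖ ^ 2 := by positivity
    linarith
  -- Expanding the square leaves the error `α² ‖g k‖²`. Sufficient decrease pays for it out of the
  -- values, which fixes the weight `α² / c` in the Lyapunov function.
  have key : ∀ z, (∀ k, φ k + inner ℝ (g k) (z - p k) ≤ v) → ∀ k,
      ‖p (k + 1) - z‖ ^ 2 + α ^ 2 / c * (φ (k + 1) - v) + 2 * α * (φ k - v) ≤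
        ‖p k - z‖ ^ 2 + α ^ 2 / c * (φ k - v) := by
    intro z hz k
    have h1 : ‖p (k + 1) - z‖ ^ 2 =
        ‖p k - z‖ ^ 2 + 2 * α * inner ℝ (g k) (z - p k) + α ^ 2 * ‖g k‖ ^ 2 := by
      have : p (k + 1) - z = (p k - z) - α • g k := by rw [hstep]; abel
      rw [this, norm_sub_sq_real, inner_smul_right, norm_smul, mul_pow, Real.norm_eq_abs, sq_abs,
        real_inner_comm, ← neg_sub z (p k), inner_neg_right]
      ring
    have h2 : α ^ 2 * ‖g k‖ ^ 2 ≤ α ^ 2 / c * (φ k - φ (k + 1)) := by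
      rw [div_mul_eq_mul_div, le_div_iff₀ hc]
      nlinarith [hdec k, sq_nonneg α]
    have h3 : 2 * α * inner ℝ (g k) (z - p k) ≤ 2 * α * (v - φ k) :=
      mul_le_mul_of_nonneg_left (by linarith [hz k]) (by positivity)
    rw [h1]
    linarith
  have hacc : ∀ z, (∀ k, φ k + inner ℝ (g k) (z - p k) ≤ v) → ∀ k : ℕ,
      ‖p k - z‖ ^ 2 + α ^ 2 / c * (φ k - v) + 2 * α * (k * (φ k - v)) ≤
        ‖p 0 - z‖ ^ 2 + α ^ 2 / c * (φ 0 - v) := by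
    intro z hz k
    induction k with
    | zero => simp
    | succ k ih =>
      have h1 := key z hz k
      have h2 : ((k : ℝ) + 1) * (φ (k + 1) - v) ≤ (k + 1) * (φ k - v) :=
        mul_le_mul_of_nonneg_left (by linarith [hanti k.le_succ]) (by positivity)
      push_cast
      nlinarith [mul_le_mul_of_nonneg_left h2 hα.le]
  set K := ‖p 0 - z₀‖ ^ 2 + α ^ 2 / c * (φ 0 - v) with hK
  have hq : 0 ≤ α ^ 2 / c := by positivity
  have hK0 : 0 ≤ K := by
    have := mul_nonneg hq (sub_nonneg.2 (hlow 0)); positivity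
  have hrate : ∀ k : ℕ, (k + 1) * (φ k - v) ≤ K / (2 * α) + (φ 0 - v) := by
    intro k
    have h1 := hacc z₀ hz₀ k
    have h2 := mul_nonneg hq (sub_nonneg.2 (hlow k))
    have h3 : (k : ℝ) * (φ k - v) ≤ K / (2 * α) := by
      rw [le_div_iff₀ (by positivity)]
      nlinarith [sq_nonneg ‖p k - z₀‖]
    have h4 := hanti k.zero_le
    linarith
  have hφ : Tendsto φ atTop (𝓝 v) := by
    have h0 : Tendsto (fun k : ℕ => v + (K / (2 * α) + (φ 0 - v)) * (1 / ((k : ℝ) + 1))) atTop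
        (𝓝 v) := by
      simpa using (tendsto_one_div_add_atTop_nhds_zero_nat (𝕜 := ℝ)).const_mul
        (K / (2 * α) + (φ 0 - v)) |>.const_add v
    refine tendsto_of_tendsto_of_tendsto_of_le_of_le tendsto_const_nhds h0 hlow fun k => ?_
    have : φ k - v ≤ (K / (2 * α) + (φ 0 - v)) / ((k : ℝ) + 1) := by
      rw [le_div_iff₀ (by positivity)]; linarith [hrate k]
    simp only [mul_one_div]
    linarith
  have hbdd : ∀ k, p k ∈ Metric.closedBall z₀ (Real.sqrt K) := by
    intro k
    rw [mem_closedBall_iff_norm]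
    apply Real.le_sqrt_of_sq_le
    have h1 := hacc z₀ hz₀ k
    have h2 := mul_nonneg hq (sub_nonneg.2 (hlow k))
    have h3 : 0 ≤ 2 * α * ((k : ℝ) * (φ k - v)) := by
      have := sub_nonneg.2 (hlow k); positivity
    linarith
  obtain ⟨z, -, ψ, hψ, hlim⟩ := (isCompact_closedBall z₀ (Real.sqrt K)).tendsto_subseq hbdd
  -- The cluster point inherits the inequality assumed of `z₀` by passing to the limit in `hsub`; no
  -- function defined off the iterates is needed.
  have hz : ∀ k, φ k + inner ℝ (g k) (z - p k) ≤ v := by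
    intro k
    have h1 : Tendsto (fun l => φ k + inner ℝ (g k) (p (ψ l) - p k)) atTop
        (𝓝 (φ k + inner ℝ (g k) (z - p k))) :=
      ((tendsto_const_nhds.inner (hlim.sub_const _))).const_add _
    exact le_of_tendsto_of_tendsto' h1 (hφ.comp hψ.tendsto_atTop) fun l => hsub k (ψ l)
  refine ⟨z, ?_, hφ, _, add_nonneg (div_nonneg hK0 (by positivity)) (sub_nonneg.2 (hlow 0)), hrate⟩
  -- The Lyapunov function centred at `z` is antitone and vanishes along `ψ`, hence along the whole
  -- sequence.
  set a : ℕ → ℝ := fun k => ‖p k - z‖ ^ 2 + α ^ 2 / c * (φ k - v) with ha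
  have ha_anti : Antitone a := antitone_nat_of_succ_le fun k => by
    have := key z hz k
    have : 0 ≤ 2 * α * (φ k - v) := by have := sub_nonneg.2 (hlow k); positivity
    simp only [ha]; linarith
  have hφ0 : Tendsto (fun k => α ^ 2 / c * (φ k - v)) atTop (𝓝 0) := by
    simpa using (hφ.sub_const v).const_mul (α ^ 2 / c)
  have ha_sub : Tendsto (a ∘ ψ) atTop (𝓝 0) := by
    have h1 : Tendsto (fun l => ‖p (ψ l) - z‖ ^ 2) atTop (𝓝 0) := by
      simpa using ((hlim.sub_const z).norm).pow 2
    have := h1.add (hφ0.comp hψ.tendsto_atTop)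
    rwa [add_zero] at this
  have ha0 : Tendsto a atTop (𝓝 0) :=
    (tendsto_iff_tendsto_subseq_of_antitone ha_anti hψ.tendsto_atTop).2 ha_sub
  have hsq : Tendsto (fun k => ‖p k - z‖ ^ 2) atTop (𝓝 0) := by
    simpa [ha] using ha0.sub hφ0
  rw [tendsto_iff_norm_sub_tendsto_zero]
  simpa using hsq.sqrt

/-- Sufficient decrease makes the gradients tend to zero when the values are bounded below. -/
theorem tendsto_zero_of_sufficient_decrease {E : Type*} [SeminormedAddCommGroup E] (g : ℕ → E)
    (φ : ℕ → ℝ) (c v : ℝ) (hc : 0 < c) (hdec : ∀ k, φ (k + 1) ≤ φ k - c * ‖g k‖ ^ 2)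
    (hlow : ∀ k, v ≤ φ k) : Tendsto g atTop (𝓝 0) := by
  have hanti : Antitone φ := antitone_nat_of_succ_le fun k => by
    have := hdec k
    have : 0 ≤ c * ‖g k‖ ^ 2 := by positivity
    linarith
  have hlim := tendsto_atTop_ciInf hanti ⟨v, by rintro _ ⟨k, rfl⟩; exact hlow k⟩
  have h1 : Tendsto (fun k => (φ k - φ (k + 1)) / c) atTop (𝓝 0) := by
    simpa using (hlim.sub (hlim.comp (tendsto_add_atTop_nat 1))).div_const c
  have h2 : Tendsto (fun k => ‖g k‖ ^ 2) atTop (𝓝 0) :=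
    squeeze_zero (fun k => by positivity)
      (fun k => by rw [le_div_iff₀ hc]; linarith [hdec k]) h1
  rw [tendsto_zero_iff_norm_tendsto_zero]
  simpa using h2.sqrt

/-- Quadratic growth at a maximizer of a strongly concave function minus a linear one. -/
theorem StrongConcaveOn.quadratic_growth {E : Type*} [NormedAddCommGroup E] [NormedSpace ℝ E]
    {D : Set E} {σ : ℝ} {f : E → ℝ} (hf : StrongConcaveOn D σ f) (l : E →ₗ[ℝ] ℝ) {x z : E}
    (hx : x ∈ D) (hz : z ∈ D) (hmax : ∀ y ∈ D, f y - l y ≤ f x - l x) :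
    f z - l z + σ / 2 * ‖z - x‖ ^ 2 ≤ f x - l x := by
  set N := σ / 2 * ‖z - x‖ ^ 2 with hN
  -- Compare `x` with the segment point `t • z + (1 - t) • x`, divide by `t`, then let `t → 0`.
  have h : ∀ t : ℝ, 0 < t → t < 1 → f z - l z + (1 - t) * N ≤ f x - l x := by
    intro t h0 h1
    have hcomb := hf.2 hz hx h0.le (sub_nonneg.2 h1.le) (add_sub_cancel t 1)
    have hle := hmax _ (hf.1 hz hx h0.le (sub_nonneg.2 h1.le) (add_sub_cancel t 1))
    simp only [smul_eq_mul, map_add, map_smul] at hcomb hle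
    rw [← hN] at hcomb
    have : t * (f z - l z + (1 - t) * N) ≤ t * (f x - l x) := by linarith
    exact le_of_mul_le_mul_left this h0
  have hlim : Tendsto (fun t : ℝ => f z - l z + (1 - t) * N) (𝓝[>] 0) (𝓝 (f z - l z + N)) := by
    have : Continuous fun t : ℝ => f z - l z + (1 - t) * N := by fun_prop
    simpa using (this.tendsto 0).mono_left nhdsWithin_le_nhds
  refine le_of_tendsto hlim ?_
  filter_upwards [Ioo_mem_nhdsGT (zero_lt_one' ℝ)] with t ht using h t ht.1 ht.2

/-! ### The dual at common prices, demands and optimal bundles -/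

namespace FisherMarket

variable {n m : ℕ} (M : FisherMarket n m)

/-- `x` enters only the consensus constraints, so `BᵀB` is the identity. -/
theorem rhoBtB_eq_one [Nonempty (Fin n × Fin m)] : rhoBtB n m = 1 := by
  have h : (xCoeff n m)ᵀ * xCoeff n m = 1 := by
    simp [xCoeff, Matrix.transpose_fromRows, Matrix.fromCols_mul_fromRows]
  rw [rhoBtB, h, spectralRadius, spectrum.one_eq]
  simp

/-- Without agents or goods the spectral radius is `0`, and division by zero turns the step bound
into `β < 0`. -/
theorem nonempty_and_lt_of_step {β σ : ℝ} (hβ : 0 < β) (hstep : β < 2 * σ / rhoBtB n m) :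
    0 < n ∧ β < 2 * σ := by
  rcases isEmpty_or_nonempty (Fin n × Fin m) with h | h
  · have : rhoBtB n m = 0 := by
      rw [rhoBtB, spectralRadius, spectrum.of_subsingleton]
      simp
    rw [this, div_zero] at hstep
    exact absurd hstep hβ.le.not_gt
  · rw [rhoBtB_eq_one, div_one] at hstep
    exact ⟨Fin.pos h.some.1, hstep⟩

/-- The Lagrangian at equal individual and market prices. -/
noncomputable def priceLagrangian (p : Fin m → ℝ) (x : Fin n → Fin m → ℝ) : ℝ :=
  ∑ i, (M.budget i * Real.log (M.utility i (x i)) - p ⬝ᵥ x i) + p ⬝ᵥ M.capacity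

/-- The excess supply at the allocation `x`. -/
def excessSupply (x : Fin n → Fin m → ℝ) : Fin m → ℝ := M.capacity - ∑ i, x i

theorem priceLagrangian_eq (p : Fin m → ℝ) (x : Fin n → Fin m → ℝ) :
    M.priceLagrangian p x =
      ∑ i, M.budget i * Real.log (M.utility i (x i)) + M.excessSupply x ⬝ᵥ p := by
  rw [priceLagrangian, excessSupply, sub_dotProduct, sum_dotProduct, Finset.sum_sub_distrib,
    dotProduct_comm p M.capacity]
  simp only [dotProduct_comm p]
  ring

/-- Affineness in the price: with `priceLagrangian_le` it makes excess supply at demands a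
subgradient of the dual. -/
theorem priceLagrangian_add_dotProduct (p p' : Fin m → ℝ) (x : Fin n → Fin m → ℝ) :
    M.priceLagrangian p x + M.excessSupply x ⬝ᵥ (p' - p) = M.priceLagrangian p' x := by
  rw [priceLagrangian_eq, priceLagrangian_eq, dotProduct_sub]
  ring

theorem lagrangian_eq_priceLagrangian (p : Fin m → ℝ) (x y : Fin n → Fin m → ℝ) :
    M.lagrangian p (fun _ => p) x y = M.priceLagrangian p x := by
  simp only [lagrangian, priceLagrangian, dotProduct, mul_sub, Finset.sum_sub_distrib,
    Finset.mul_sum]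
  rw [Finset.sum_comm (f := fun i j => p j * y i j)]
  ring

theorem lagrangian_of_cleared {x : Fin n → Fin m → ℝ} (hx : ∀ j, ∑ i, x i j = M.capacity j)
    (p : Fin m → ℝ) (q : Fin n → Fin m → ℝ) :
    M.lagrangian p q x x = ∑ i, M.budget i * Real.log (M.utility i (x i)) := by
  simp [lagrangian, hx]

variable {M}

theorem priceLagrangian_le {p : Fin m → ℝ} {x z : Fin n → Fin m → ℝ}
    (hx : ∀ i, M.IsDemand p i (x i)) (hz : ∀ i, z i ∈ M.domain i) :
    M.priceLagrangian p z ≤ M.priceLagrangian p x :=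
  add_le_add_left (Finset.sum_le_sum fun i _ => (hx i).2 _ (hz i)) _

/-- The Lagrangian is separable over agents, so changing one bundle at a time suffices. -/
theorem isDemand_of_priceLagrangian_max {p : Fin m → ℝ} {x : Fin n → Fin m → ℝ}
    (hx : ∀ i, x i ∈ M.domain i)
    (hmax : ∀ z : Fin n → Fin m → ℝ, (∀ i, z i ∈ M.domain i) →
      M.priceLagrangian p z ≤ M.priceLagrangian p x) (i : Fin n) : M.IsDemand p i (x i) := by
  refine ⟨hx i, fun z hz => ?_⟩
  have h := hmax (Function.update x i z) fun i' => by
    rcases eq_or_ne i' i with rfl | h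
    · simpa using hz
    · simpa [h] using hx i'
  rw [priceLagrangian, priceLagrangian, add_le_add_iff_right,
    ← Finset.add_sum_erase _ _ (Finset.mem_univ i),
    ← Finset.add_sum_erase (a := i) _ (fun i => _ - p ⬝ᵥ x i) (Finset.mem_univ i)] at h
  rw [Finset.sum_congr rfl (g := fun i => M.budget i * Real.log (M.utility i (x i)) - p ⬝ᵥ x i)
    fun i' hi' => by rw [Function.update_of_ne (Finset.ne_of_mem_erase hi')]] at h
  simpa using h

theorem dual_eq_priceLagrangian {p : Fin m → ℝ} {x : Fin n → Fin m → ℝ}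
    (hx : ∀ i, M.IsDemand p i (x i)) :
    M.dual p (fun _ => p) = (M.priceLagrangian p x : EReal) := by
  apply le_antisymm
  · refine iSup₂_le fun z hz => iSup_le fun y => ?_
    rw [lagrangian_eq_priceLagrangian]
    exact EReal.coe_le_coe_iff.2 (priceLagrangian_le hx hz)
  · rw [← M.lagrangian_eq_priceLagrangian p x x]
    exact le_iSup₂_of_le x (fun i => (hx i).1)
      (le_iSup (fun y => (M.lagrangian p (fun _ => p) x y : EReal)) x)

/-- Weak duality: with `y = x` cleared, both multiplier terms vanish. -/
theorem le_dual {x : Fin n → Fin m → ℝ} (hx : ∀ i, x i ∈ M.domain i)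
    (hs : ∀ j, ∑ i, x i j = M.capacity j) (p : Fin m → ℝ) (q : Fin n → Fin m → ℝ) :
    ((∑ i, M.budget i * Real.log (M.utility i (x i)) : ℝ) : EReal) ≤ M.dual p q := by
  rw [← M.lagrangian_of_cleared hs p q]
  exact le_iSup₂_of_le x hx (le_iSup (fun y => (M.lagrangian p q x y : EReal)) x)

theorem smul_mem_domain (hhom : M.HomogeneousUtilities) {i : Fin n} {x : Fin m → ℝ}
    (hx : x ∈ M.domain i) {t : ℝ} (ht : 0 < t) : t • x ∈ M.domain i := by
  refine ⟨⟨fun j => mul_nonneg ht.le (hx.1.1 j), fun c => ?_⟩, ?_⟩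
  · rw [Matrix.mulVec_smul]
    exact mul_nonpos_of_nonneg_of_nonpos ht.le (hx.1.2 c)
  · rw [hhom i x hx.1 t ht]
    exact mul_pos ht hx.2

/-- Along the ray `t • x` the objective changes by `w log t - (t - 1) q·x`, which is maximal at `t =
1`; its derivative there vanishes. -/
theorem IsDemand.dotProduct_eq (hhom : M.HomogeneousUtilities) {q : Fin m → ℝ} {i : Fin n}
    {x : Fin m → ℝ} (hx : M.IsDemand q i x) : q ⬝ᵥ x = M.budget i := by
  have hw := M.budget_pos i
  have h : ∀ t : ℝ, 0 < t → M.budget i * Real.log t - (t - 1) * (q ⬝ᵥ x) ≤ 0 := by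
    intro t ht
    have := hx.2 _ (smul_mem_domain hhom hx.1 ht)
    rw [hhom i x hx.1.1 t ht, Real.log_mul ht.ne' hx.1.2.ne', dotProduct_smul, smul_eq_mul] at this
    linarith
  have hd : HasDerivAt (fun t : ℝ => M.budget i * Real.log t - (t - 1) * (q ⬝ᵥ x))
      (M.budget i * 1⁻¹ - 1 * (q ⬝ᵥ x)) 1 :=
    ((Real.hasDerivAt_log one_ne_zero).const_mul _).sub
      (((hasDerivAt_id (1 : ℝ)).sub_const 1).mul_const _)
  have hmax : IsLocalMax (fun t : ℝ => M.budget i * Real.log t - (t - 1) * (q ⬝ᵥ x)) 1 := by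
    filter_upwards [lt_mem_nhds (zero_lt_one' ℝ)] with t ht
    simpa using h t ht
  have := hmax.hasDerivAt_eq_zero hd
  linarith

theorem IsDemand.isOptimalBundle (hhom : M.HomogeneousUtilities) {q : Fin m → ℝ} {i : Fin n}
    {x : Fin m → ℝ} (hx : M.IsDemand q i x) : M.IsOptimalBundle q i x := by
  refine ⟨hx.1.1, (hx.dotProduct_eq hhom).le, fun z hz hqz => ?_⟩
  rcases le_or_gt (M.utility i z) 0 with h | h
  · exact h.trans hx.1.2.le
  · have h1 := hx.2 z ⟨hz, h⟩
    rw [hx.dotProduct_eq hhom] at h1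
    have h2 : M.budget i * Real.log (M.utility i z) ≤ M.budget i * Real.log (M.utility i x) := by
      linarith
    exact (Real.log_le_log_iff h hx.1.2).1 (le_of_mul_le_mul_left h2 (M.budget_pos i))

/-- Any bundle of positive utility can be rescaled to cost exactly `w`, and `log t ≥ 1 - 1 / t`
compares the two objectives. The witness `z₀` rules out an optimal utility of zero. -/
theorem IsOptimalBundle.isDemand (hhom : M.HomogeneousUtilities) {q : Fin m → ℝ} {i : Fin n}
    {x z₀ : Fin m → ℝ} (hx : M.IsOptimalBundle q i x) (hq : q ⬝ᵥ x = M.budget i)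
    (hz₀ : z₀ ∈ M.domain i) : M.IsDemand q i x := by
  have hw := M.budget_pos i
  have hscale : ∀ z ∈ M.domain i, ∀ t : ℝ, 0 < t → t * (q ⬝ᵥ z) ≤ M.budget i →
      t * M.utility i z ≤ M.utility i x := by
    intro z hz t ht hle
    rw [← hhom i z hz.1 t ht]
    exact hx.2.2 _ (smul_mem_domain hhom hz ht).1 (by rwa [dotProduct_smul, smul_eq_mul])
  have hux : 0 < M.utility i x := by
    have hd : 0 < |q ⬝ᵥ z₀| + 1 := by positivity
    refine (mul_pos (div_pos hw hd) hz₀.2).trans_le (hscale z₀ hz₀ _ (div_pos hw hd) ?_)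
    rw [div_mul_eq_mul_div, div_le_iff₀ hd]
    exact mul_le_mul_of_nonneg_left (by linarith [le_abs_self (q ⬝ᵥ z₀)]) hw.le
  refine ⟨⟨hx.1, hux⟩, fun z hz => ?_⟩
  -- A bundle of nonpositive cost stays affordable under any scaling, so it could be scaled up to
  -- utility `u(x) + 1`.
  have hqz : 0 < q ⬝ᵥ z := by
    by_contra! hneg
    have ht : 0 < (M.utility i x + 1) / M.utility i z := div_pos (by linarith) hz.2
    have := hscale z hz _ ht ((mul_nonpos_of_nonneg_of_nonpos ht.le hneg).trans hw.le)
    rw [div_mul_cancel₀ _ hz.2.ne'] at this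
    linarith
  have ht : 0 < M.budget i / (q ⬝ᵥ z) := div_pos hw hqz
  have h1 := hscale z hz _ ht (div_mul_cancel₀ _ hqz.ne').le
  have h2 := Real.log_le_log (mul_pos ht hz.2) h1
  rw [Real.log_mul ht.ne' hz.2.ne'] at h2
  have h3 := Real.one_sub_inv_le_log_of_pos ht
  rw [inv_div] at h3
  have h4 : M.budget i * Real.log (M.utility i z) ≤
      M.budget i * (Real.log (M.utility i x) - (1 - (q ⬝ᵥ z) / M.budget i)) :=
    mul_le_mul_of_nonneg_left (by linarith) hw.le
  have h5 : M.budget i * ((q ⬝ᵥ z) / M.budget i) = q ⬝ᵥ z := mul_div_cancel₀ _ hw.ne'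
  rw [hq]
  nlinarith

end FisherMarket

/-! ### Reduction of AMA to a gradient method -/

namespace FisherMarket

variable {n m : ℕ} {M : FisherMarket n m}

/-- First order condition of the `y`-update. -/
theorem yObjective_stationary {β : ℝ} {p : Fin m → ℝ} {q x y : Fin n → Fin m → ℝ}
    (hy : ∀ z, M.yObjective β p q x z ≤ M.yObjective β p q x y) (i : Fin n) (j : Fin m) :
    q i j + β * (x i j - y i j) = p j + β * (∑ i, y i j - M.capacity j) := by
  set r : Fin m → ℝ := fun j => ∑ i, y i j - M.capacity j with hr
  -- `G` is the gradient at `y`. Moving by `t • G` changes the objective by exactly `t S - t² Q`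
  -- with `S = ‖G‖²`, so maximality and `t → 0⁺` give `S ≤ 0`.
  set G : Fin n → Fin m → ℝ := fun i j =>
    q i j + β * (x i j - y i j) - (p j + β * r j) with hG
  set S : ℝ := ∑ i, ∑ j, G i j ^ 2 with hS
  set Q : ℝ := β / 2 * S + β / 2 * ∑ j, (∑ i, G i j) ^ 2 with hQ
  have hexp : ∀ t : ℝ, M.yObjective β p q x (y + t • G) =
      M.yObjective β p q x y + t * S - t ^ 2 * Q := by
    intro t
    have hsum : ∀ j, ∑ i, (y + t • G) i j - M.capacity j = r j + t * ∑ i, G i j := by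
      intro j
      simp only [hr, Pi.add_apply, Pi.smul_apply, smul_eq_mul, Finset.sum_add_distrib,
        Finset.mul_sum]
      ring
    have hsq : S = ∑ i, ∑ j, q i j * G i j + β * ∑ i, ∑ j, (x i j - y i j) * G i j -
        ∑ j, p j * ∑ i, G i j - β * ∑ j, r j * ∑ i, G i j := by
      simp only [Finset.mul_sum]
      rw [Finset.sum_comm (s := Finset.univ (α := Fin m)),
        Finset.sum_comm (s := Finset.univ (α := Fin m))]
      simp only [hS, ← Finset.sum_sub_distrib, ← Finset.sum_add_distrib]
      refine Finset.sum_congr rfl fun i _ => Finset.sum_congr rfl fun j _ => ?_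
      simp only [hG]
      ring
    have hlin : ∑ i, ∑ j, q i j * (y + t • G) i j =
        ∑ i, ∑ j, q i j * y i j + t * ∑ i, ∑ j, q i j * G i j := by
      simp only [Finset.mul_sum, ← Finset.sum_add_distrib, Pi.add_apply, Pi.smul_apply, smul_eq_mul]
      refine Finset.sum_congr rfl fun i _ => Finset.sum_congr rfl fun j _ => ?_
      ring
    have hdist : ∑ i, ∑ j, (x i j - (y + t • G) i j) ^ 2 =
        ∑ i, ∑ j, (x i j - y i j) ^ 2 - 2 * t * ∑ i, ∑ j, (x i j - y i j) * G i j + t ^ 2 * S := by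
      simp only [hS, Finset.mul_sum, ← Finset.sum_add_distrib, ← Finset.sum_sub_distrib,
        Pi.add_apply, Pi.smul_apply, smul_eq_mul]
      refine Finset.sum_congr rfl fun i _ => Finset.sum_congr rfl fun j _ => ?_
      ring
    have hprice : ∑ j, p j * (r j + t * ∑ i, G i j) =
        ∑ j, p j * r j + t * ∑ j, p j * ∑ i, G i j := by
      rw [Finset.mul_sum, ← Finset.sum_add_distrib]
      exact Finset.sum_congr rfl fun j _ => by ring
    have hres : ∑ j, (r j + t * ∑ i, G i j) ^ 2 =
        ∑ j, r j ^ 2 + 2 * t * ∑ j, r j * ∑ i, G i j + t ^ 2 * ∑ j, (∑ i, G i j) ^ 2 := by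
      simp only [Finset.mul_sum (s := Finset.univ (α := Fin m)), ← Finset.sum_add_distrib]
      exact Finset.sum_congr rfl fun j _ => by ring
    simp only [yObjective, hsum, hlin, hdist, hprice, hres]
    linear_combination -t * hsq
  have hle : ∀ t : ℝ, t * S ≤ t ^ 2 * Q := fun t => by linarith [hy (y + t • G), hexp t]
  have hS0 : S ≤ 0 := by
    have hlim : Tendsto (fun t : ℝ => t * Q) (𝓝[>] 0) (𝓝 0) := by
      have : Continuous fun t : ℝ => t * Q := by fun_prop
      simpa using (this.tendsto 0).mono_left nhdsWithin_le_nhds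
    refine ge_of_tendsto hlim ?_
    filter_upwards [self_mem_nhdsWithin] with t ht
    have := hle t
    rw [sq, mul_assoc] at this
    exact le_of_mul_le_mul_left this ht
  have hS1 : S = 0 := hS0.antisymm (by positivity)
  rw [hS, Finset.sum_eq_zero_iff_of_nonneg fun i _ => by positivity] at hS1
  have h1 := hS1 i (Finset.mem_univ i)
  rw [Finset.sum_eq_zero_iff_of_nonneg fun i _ => by positivity] at h1
  exact sub_eq_zero.1 (pow_eq_zero_iff two_ne_zero |>.1 (h1 j (Finset.mem_univ j)))

section Run

variable {β : ℝ} {p : ℕ → Fin m → ℝ} {q x y : ℕ → Fin n → Fin m → ℝ}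

/-- The two sides of the stationarity condition are the two multiplier updates. Since `q 0` is
arbitrary, equality starts at index `1`. -/
theorem IsAMARun.price_eq (h : M.IsAMARun β p q x y) (k : ℕ) :
    q (k + 1) = fun _ => p (k + 1) := by
  funext i j
  rw [h.q_step, h.p_step]
  exact yObjective_stationary (h.y_step k) i j

theorem IsAMARun.isDemand (h : M.IsAMARun β p q x y) (k : ℕ) (i : Fin n) :
    M.IsDemand (p (k + 1)) i (x (k + 2) i) := by
  have := h.x_step (k + 1) i
  rwa [h.price_eq k] at this

/-- After the first iteration, the algorithm is a gradient method (tâtonnement). -/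
theorem IsAMARun.gradient_step (h : M.IsAMARun β p q x y) (hβ : 0 < β) (k : ℕ) :
    p (k + 2) = p (k + 1) - (β / (n + 1)) • M.excessSupply (x (k + 2)) := by
  funext j
  have h1 : ∀ i, x (k + 2) i j - y (k + 2) i j = ∑ i, y (k + 2) i j - M.capacity j := by
    intro i
    have h2 := h.q_step (k + 1) i j
    rw [h.price_eq, h.price_eq] at h2
    have h3 := h.p_step (k + 1) j
    dsimp only at h2
    exact mul_left_cancel₀ hβ.ne' (by linarith)
  -- Summing the `n` equal gaps and adding the market residual itself produces the factor `n + 1`.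
  have h2 : ∑ i, x (k + 2) i j - M.capacity j =
      (n + 1) * (∑ i, y (k + 2) i j - M.capacity j) := by
    have h3 := Finset.sum_congr (rfl : Finset.univ = Finset.univ) fun i _ => h1 i
    rw [Finset.sum_sub_distrib, Finset.sum_const, Finset.card_univ, Fintype.card_fin,
      nsmul_eq_mul] at h3
    linarith
  have hn : (n : ℝ) + 1 ≠ 0 := by positivity
  simp only [Pi.sub_apply, Pi.smul_apply, smul_eq_mul, excessSupply, Finset.sum_apply]
  rw [h.p_step (k + 1) j, ← neg_sub (∑ i, x (k + 2) i j), h2]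
  field_simp
  ring

end Run

/-! ### Sufficient decrease of the dual values -/

theorem quadratic_growth {D : Set (EuclideanSpace ℝ (Fin n × Fin m))}
    (hD : ∀ z ∈ D, ∀ i, (fun j => z (i, j)) ∈ M.domain i) {σ : ℝ}
    (hσ : StrongConcaveOn D σ M.objective) {p : Fin m → ℝ} {x z : Fin n → Fin m → ℝ}
    (hx : ∀ i, M.IsDemand p i (x i)) (hxD : stack x ∈ D) (hzD : stack z ∈ D) :
    M.priceLagrangian p z + σ / 2 * ‖stack z - stack x‖ ^ 2 ≤ M.priceLagrangian p x := by
  let l : EuclideanSpace ℝ (Fin n × Fin m) →ₗ[ℝ] ℝ :=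
    { toFun := fun z => ∑ i, p ⬝ᵥ fun j => z (i, j)
      map_add' := fun a b => by
        simp [dotProduct, mul_add, Finset.sum_add_distrib]
      map_smul' := fun t a => by
        simp [dotProduct, Finset.mul_sum, mul_left_comm] }
  have hl : ∀ z : EuclideanSpace ℝ (Fin n × Fin m),
      M.priceLagrangian p (fun i j => z (i, j)) = M.objective z - l z + p ⬝ᵥ M.capacity := by
    intro z
    simp only [priceLagrangian, objective, l, Finset.sum_sub_distrib, LinearMap.coe_mk,
      AddHom.coe_mk]
  have := hσ.quadratic_growth l hxD hzD fun z hz => by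
    have := priceLagrangian_le hx (hD z hz)
    rw [hl z] at this
    have h2 := hl (stack x)
    change M.priceLagrangian p x = _ at h2
    linarith
  have h1 := hl (stack x)
  have h2 := hl (stack z)
  change M.priceLagrangian p x = _ at h1
  change M.priceLagrangian p z = _ at h2
  linarith

/-- Cauchy–Schwarz over the `n` agents, good by good. -/
theorem excessSupply_dist_le (x z : Fin n → Fin m → ℝ) :
    ‖WithLp.toLp 2 (M.excessSupply z) - WithLp.toLp 2 (M.excessSupply x)‖ ^ 2 ≤
      n * ‖stack z - stack x‖ ^ 2 := by
  rw [EuclideanSpace.real_norm_sq_eq, EuclideanSpace.real_norm_sq_eq, Fintype.sum_prod_type,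
    Finset.sum_comm, Finset.mul_sum]
  refine Finset.sum_le_sum fun j _ => ?_
  have h := sq_sum_le_card_mul_sum_sq (s := (Finset.univ : Finset (Fin n)))
    (f := fun i => z i j - x i j)
  rw [Finset.card_univ, Fintype.card_fin] at h
  refine le_trans (le_of_eq ?_) h
  simp only [excessSupply, PiLp.sub_apply, Pi.sub_apply, Finset.sum_apply, Finset.sum_sub_distrib]
  ring

/-- At the old price, replacing `x` by `x'` costs at least `σ / (2n) ‖d‖²`, where `d` is the change
of excess supply. The price move then adds `-α (‖g‖² + ⟪d, g⟫)`, and completing the square in `d`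
removes the cross term. -/
theorem sufficient_decrease {D : Set (EuclideanSpace ℝ (Fin n × Fin m))}
    (hD : ∀ z ∈ D, ∀ i, (fun j => z (i, j)) ∈ M.domain i) {σ : ℝ}
    (hσ : StrongConcaveOn D σ M.objective) (hσ0 : 0 < σ) (hn : 0 < n) {α : ℝ} {p p' : Fin m → ℝ}
    {x x' : Fin n → Fin m → ℝ} (hx : ∀ i, M.IsDemand p i (x i))
    (hxD : stack x ∈ D) (hxD' : stack x' ∈ D) (hp' : p' = p - α • M.excessSupply x) :
    M.priceLagrangian p' x' ≤ M.priceLagrangian p x -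
      α * (1 - α * n / (2 * σ)) * ‖WithLp.toLp 2 (M.excessSupply x)‖ ^ 2 := by
  have h1 := quadratic_growth hD hσ hx hxD hxD'
  have h2 := excessSupply_dist_le (M := M) x x'
  have h3 := M.priceLagrangian_add_dotProduct p p' x'
  set g := WithLp.toLp 2 (M.excessSupply x) with hg
  set d := WithLp.toLp 2 (M.excessSupply x') - g with hd
  have hn' : (0 : ℝ) < n := by exact_mod_cast hn
  have h4 : M.excessSupply x' ⬝ᵥ (p' - p) = -(α * (‖g‖ ^ 2 + inner ℝ d g)) := by
    have : inner ℝ (WithLp.toLp 2 (M.excessSupply x')) g = ‖g‖ ^ 2 + inner ℝ d g := by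
      rw [hd, inner_sub_left, real_inner_self_eq_norm_sq]; ring
    rw [← this, hp', hg, EuclideanSpace.inner_toLp_toLp, star_trivial, sub_sub_cancel_left,
      dotProduct_neg, dotProduct_smul, dotProduct_comm, smul_eq_mul]
  have h5 : σ / 2 * (‖d‖ ^ 2 / n) ≤ σ / 2 * ‖stack x' - stack x‖ ^ 2 :=
    mul_le_mul_of_nonneg_left ((div_le_iff₀' hn').2 h2) (by positivity)
  have h6 : ‖σ • d + (α * n) • g‖ ^ 2 / (2 * σ * n) =
      σ / 2 * (‖d‖ ^ 2 / n) + α * inner ℝ d g + α * (α * n / (2 * σ)) * ‖g‖ ^ 2 := by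
    rw [norm_add_sq_real, norm_smul, norm_smul, inner_smul_left, inner_smul_right, mul_pow,
      mul_pow, Real.norm_eq_abs, Real.norm_eq_abs, sq_abs, sq_abs]
    simp only [conj_trivial]
    field_simp
  have h7 : 0 ≤ ‖σ • d + (α * n) • g‖ ^ 2 / (2 * σ * n) := by positivity
  rw [h4] at h3
  linarith

end FisherMarket

/-! ### Limit prices and existence of an equilibrium -/

namespace FisherMarket

variable {n m : ℕ} {M : FisherMarket n m}

/-- Gradient descent on the dual, at prices with demands `x k`, converges to an equilibrium price
as soon as there is an equilibrium. -/
theorem exists_limit_of_gradient (hhom : M.HomogeneousUtilities) {α c : ℝ} (hα : 0 < α)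
    (hc : 0 < c) {p : ℕ → Fin m → ℝ} {x : ℕ → Fin n → Fin m → ℝ}
    (hx : ∀ k i, M.IsDemand (p k) i (x k i))
    (hstep : ∀ k, p (k + 1) = p k - α • M.excessSupply (x k))
    (hdec : ∀ k, M.priceLagrangian (p (k + 1)) (x (k + 1)) ≤ M.priceLagrangian (p k) (x k) -
      c * ‖WithLp.toLp 2 (M.excessSupply (x k))‖ ^ 2)
    (hEq : ∃ pEq, M.IsEquilibriumPrice pEq) :
    ∃ pStar : Fin m → ℝ, M.IsEquilibriumPrice pStar ∧ Tendsto p atTop (𝓝 pStar) ∧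
      ∃ v : ℝ, M.dual pStar (fun _ => pStar) = (v : EReal) ∧
        (∀ p' q', (v : EReal) ≤ M.dual p' q') ∧
        ∃ C : ℝ, ∀ k : ℕ, M.priceLagrangian (p k) (x k) ≤ v + C / (k + 1) := by
  obtain ⟨pEq, z, hzopt, hzs, hzb⟩ := hEq
  have hzd : ∀ i, M.IsDemand pEq i (z i) := fun i =>
    (hzopt i).isDemand hhom (hzb i) (hx 0 i).1
  set v := ∑ i, M.budget i * Real.log (M.utility i (z i)) with hv
  have hz0 : M.excessSupply z = 0 := by
    funext j
    simp [excessSupply, hzs j]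
  -- At a cleared allocation the Lagrangian does not depend on the price, so `v` bounds every dual
  -- value from below.
  have hval : ∀ p, M.priceLagrangian p z = v := fun p => by
    rw [priceLagrangian_eq, hz0, zero_dotProduct, add_zero]
  have hinner : ∀ k (p' : Fin m → ℝ), M.priceLagrangian (p k) (x k) +
      inner ℝ (WithLp.toLp 2 (M.excessSupply (x k))) (WithLp.toLp 2 p' - WithLp.toLp 2 (p k)) =
        M.priceLagrangian p' (x k) := by
    intro k p'
    rw [← WithLp.toLp_sub, EuclideanSpace.inner_toLp_toLp, star_trivial, dotProduct_comm,
      priceLagrangian_add_dotProduct]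
  obtain ⟨pS, hpS, hφ, C, -, hC⟩ := gradientDescent_converges
    (fun k => WithLp.toLp 2 (p k)) (fun k => WithLp.toLp 2 (M.excessSupply (x k)))
    (fun k => M.priceLagrangian (p k) (x k)) α c v hα hc (WithLp.toLp 2 pEq)
    (fun k => by rw [hstep k]; simp) hdec
    (fun k => by rw [← hval (p k)]; exact priceLagrangian_le (hx k) fun i => (hzd i).1)
    (fun k l => by
      rw [hinner]; exact priceLagrangian_le (hx l) fun i => (hx k i).1)
    (fun k => by
      rw [hinner, ← hval pEq]; exact priceLagrangian_le hzd fun i => (hx k i).1)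
  have hlim : Tendsto p atTop (𝓝 pS.ofLp) :=
    ((PiLp.continuous_ofLp 2 _).tendsto pS).comp hpS
  -- For each competitor, the Lagrangian is at most the dual value along the run; in the limit it is
  -- at most `v`, the Lagrangian at `z`.
  have hdem : ∀ i, M.IsDemand pS.ofLp i (z i) := by
    refine isDemand_of_priceLagrangian_max (fun i => (hzd i).1) fun z' hz' => ?_
    rw [hval]
    have hcont : Continuous fun p => M.priceLagrangian p z' := by
      simp only [priceLagrangian_eq, dotProduct]
      fun_prop
    exact le_of_tendsto_of_tendsto' ((hcont.tendsto _).comp hlim) hφ fun k =>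
      priceLagrangian_le (hx k) hz'
  refine ⟨pS.ofLp, ⟨z, fun i => (hdem i).isOptimalBundle hhom, hzs,
    fun i => (hdem i).dotProduct_eq hhom⟩, hlim, v, ?_, le_dual (fun i => (hzd i).1) hzs, C,
    fun k => ?_⟩
  · rw [dual_eq_priceLagrangian hdem, hval]
  · rw [← sub_le_iff_le_add', le_div_iff₀ (by positivity), mul_comm]
    exact hC k

/-- In a classical market with positive capacities and continuous utilities, an equilibrium exists
as soon as there is a sequence of positive prices with demands along which the dual values decrease
sufficiently. -/
theorem exists_equilibrium_of_sufficient_decrease (hhom : M.HomogeneousUtilities)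
    (hcl : M.IsClassical) (hs : ∀ j, 0 < M.capacity j)
    (hcont : ∀ i, ContinuousOn (M.utility i) {z | ∀ j, 0 ≤ z j}) {c : ℝ}
    (hc : 0 < c) {p : ℕ → Fin m → ℝ} {x : ℕ → Fin n → Fin m → ℝ}
    (hx : ∀ k i, M.IsDemand (p k) i (x k i)) (hpos : ∀ k j, 0 < p k j)
    (hdec : ∀ k, M.priceLagrangian (p (k + 1)) (x (k + 1)) ≤ M.priceLagrangian (p k) (x k) -
      c * ‖WithLp.toLp 2 (M.excessSupply (x k))‖ ^ 2) :
    ∃ pEq, M.IsEquilibriumPrice pEq := by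
  -- A Slater point: a shrunken demand using at most half of each capacity. It makes the dual
  -- coercive on positive prices, which bounds them.
  obtain ⟨t, ht, hts⟩ : ∃ t : ℝ, 0 < t ∧ ∀ j, t * ∑ i, x 0 i j ≤ M.capacity j / 2 := by
    have hev : ∀ j, ∀ᶠ t : ℝ in 𝓝[>] 0, t * ∑ i, x 0 i j ≤ M.capacity j / 2 := by
      intro j
      have hlim : Tendsto (fun t : ℝ => t * ∑ i, x 0 i j) (𝓝[>] 0) (𝓝 0) := by
        have : Continuous fun t : ℝ => t * ∑ i, x 0 i j := by fun_prop
        simpa using (this.tendsto 0).mono_left nhdsWithin_le_nhds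
      exact hlim.eventually_le_const (half_pos (hs j))
    obtain ⟨t, ht, ht'⟩ := ((eventually_all.2 hev).and self_mem_nhdsWithin).exists
    exact ⟨t, ht', ht⟩
  set z : Fin n → Fin m → ℝ := fun i => t • x 0 i with hz
  have hzd : ∀ i, z i ∈ M.domain i := fun i => smul_mem_domain hhom (hx 0 i).1 ht
  set F := ∑ i, M.budget i * Real.log (M.utility i (z i)) with hF
  set φ : ℕ → ℝ := fun k => M.priceLagrangian (p k) (x k) with hφ
  have hlow : ∀ k, F + ∑ j, M.capacity j / 2 * p k j ≤ φ k := by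
    intro k
    refine le_trans ?_ (priceLagrangian_le (hx k) hzd)
    rw [priceLagrangian_eq]
    refine add_le_add_right (Finset.sum_le_sum fun j _ =>
      mul_le_mul_of_nonneg_right ?_ (hpos k j).le) _
    have := hts j
    simp only [hz, excessSupply, Pi.sub_apply, Finset.sum_apply, Pi.smul_apply, smul_eq_mul,
      ← Finset.mul_sum]
    linarith
  have hterm : ∀ k j, 0 ≤ M.capacity j / 2 * p k j := fun k j =>
    (mul_pos (half_pos (hs j)) (hpos k j)).le
  have hanti : Antitone φ := antitone_nat_of_succ_le fun k => (hdec k).trans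
    (sub_le_self _ (by positivity))
  have hpbd : ∀ k j, p k j ≤ (φ 0 - F) / (M.capacity j / 2) := by
    intro k j
    rw [le_div_iff₀' (half_pos (hs j))]
    have h1 := Finset.single_le_sum (fun j _ => hterm k j) (Finset.mem_univ j)
    have h2 := hanti k.zero_le
    have h3 := hlow k
    linarith
  have hg0 := tendsto_zero_of_sufficient_decrease
    (fun k => WithLp.toLp 2 (M.excessSupply (x k))) φ c F hc hdec
    (fun k => (le_add_of_nonneg_right (Finset.sum_nonneg fun j _ => hterm k j)).trans (hlow k))
  have hg : ∀ j, Tendsto (fun k => M.excessSupply (x k) j) atTop (𝓝 0) := fun j =>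
    (((PiLp.continuous_apply 2 _ j).tendsto 0).comp hg0)
  have hxsum : ∀ j, Tendsto (fun k => ∑ i, x k i j) atTop (𝓝 (M.capacity j)) := by
    intro j
    simpa [excessSupply] using (hg j).const_sub (M.capacity j)
  choose R hR using fun j => (hxsum j).bddAbove_range
  have hmem : ∀ k, (p k, x k) ∈ Set.Icc ((0, 0) : (Fin m → ℝ) × (Fin n → Fin m → ℝ))
      (fun j => (φ 0 - F) / (M.capacity j / 2), fun _ => R) := by
    intro k
    refine ⟨⟨fun j => (hpos k j).le, fun i j => (hx k i).1.1.1 j⟩, fun j => hpbd k j,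
      fun i j => ?_⟩
    exact (Finset.single_le_sum (fun i _ => (hx k i).1.1.1 j) (Finset.mem_univ i)).trans
      (hR j ⟨k, rfl⟩)
  obtain ⟨⟨P, X⟩, hPX, ψ, hψ, hlim⟩ := isCompact_Icc.tendsto_subseq hmem
  have hP : Tendsto (fun l => p (ψ l)) atTop (𝓝 P) := (continuous_fst.tendsto _).comp hlim
  have hX : Tendsto (fun l => x (ψ l)) atTop (𝓝 X) := (continuous_snd.tendsto _).comp hlim
  have hXi : ∀ i, Tendsto (fun l => x (ψ l) i) atTop (𝓝 (X i)) := tendsto_pi_nhds.1 hX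
  have hX0 : ∀ i j, 0 ≤ X i j := hPX.1.2
  have hdot : ∀ w : Fin m → ℝ, Tendsto (fun l => p (ψ l) ⬝ᵥ w) atTop (𝓝 (P ⬝ᵥ w)) := by
    intro w
    have : Continuous fun p : Fin m → ℝ => p ⬝ᵥ w := by
      simp only [dotProduct]
      fun_prop
    exact (this.tendsto P).comp hP
  have hdem : ∀ i, M.IsDemand P i (X i) := by
    intro i
    have hw := M.budget_pos i
    have hu : Tendsto (fun l => M.utility i (x (ψ l) i)) atTop (𝓝 (M.utility i (X i))) :=
      (hcont i (X i) (hX0 i)).tendsto.comp (tendsto_nhdsWithin_iff.2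
        ⟨hXi i, Eventually.of_forall fun l => (hx (ψ l) i).1.1.1⟩)
    have hle : ∀ l, ∀ w ∈ M.domain i, M.budget i * Real.log (M.utility i w) - p (ψ l) ⬝ᵥ w ≤
        M.budget i * Real.log (M.utility i (x (ψ l) i)) - M.budget i := by
      intro l w hw
      have := (hx (ψ l) i).2 w hw
      rwa [(hx (ψ l) i).dotProduct_eq hhom] at this
    -- Comparison with `z i` keeps the logarithms bounded below, so the utility cannot tend to `0`.
    have hupos : 0 < M.utility i (X i) := by
      refine (Real.exp_pos _).trans_le (le_of_tendsto_of_tendsto'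
        ((Real.continuous_exp.tendsto _).comp
          (((hdot (z i)).const_sub (M.budget i * Real.log (M.utility i (z i)))).div_const
            (M.budget i))) hu fun l => ?_)
      rw [Function.comp_apply, ← Real.le_log_iff_exp_le (hx (ψ l) i).1.2, div_le_iff₀' hw]
      linarith [hle l (z i) (hzd i)]
    have hfeas : X i ∈ M.feasible i :=
      ⟨hX0 i, fun r => (Fin.cast (hcl i) r).elim0⟩
    have hbud : P ⬝ᵥ X i = M.budget i := by
      have : Continuous fun w : (Fin m → ℝ) × (Fin n → Fin m → ℝ) => w.1 ⬝ᵥ w.2 i := by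
        simp only [dotProduct]
        fun_prop
      refine tendsto_nhds_unique ((this.tendsto (P, X)).comp hlim) ?_
      refine tendsto_const_nhds.congr fun l => ?_
      exact ((hx (ψ l) i).dotProduct_eq hhom).symm
    refine ⟨⟨hfeas, hupos⟩, fun w hw' => ?_⟩
    rw [hbud]
    exact le_of_tendsto_of_tendsto' ((hdot w).const_sub _)
      (((hu.log hupos.ne').const_mul _).sub_const _) fun l => hle l w hw'
  refine ⟨P, X, fun i => (hdem i).isOptimalBundle hhom, fun j => ?_,
    fun i => (hdem i).dotProduct_eq hhom⟩
  exact tendsto_nhds_unique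
    (tendsto_finsetSum _ fun i _ => tendsto_pi_nhds.1 (hXi i) j)
    ((hxsum j).comp hψ.tendsto_atTop)

end FisherMarket

/-! ### Assembly -/

theorem mainTheorem5 {n m : ℕ} (M : FisherMarket n m)
    (hhom : M.HomogeneousUtilities) (hconc : M.StrictlyConcaveUtilities)
    (β : ℝ) (hβ : 0 < β) (p : ℕ → Fin m → ℝ) (q x y : ℕ → Fin n → Fin m → ℝ)
    (hrun : M.IsAMARun β p q x y) (hpos : ∀ k j, 0 < p k j)
    (D : Set (EuclideanSpace ℝ (Fin n × Fin m)))
    (hD : ∀ z ∈ D, ∀ i, (fun j => z (i, j)) ∈ M.domain i)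
    (hxD : ∀ k, FisherMarket.stack (x (k + 1)) ∈ D)
    (σ : ℝ) (hσ : StrongConcaveOn D σ M.objective)
    (hstep : β < 2 * σ / FisherMarket.rhoBtB n m) :
    ((∃ pEq, M.IsEquilibriumPrice pEq) → M.ConvergesToEquilibrium p q) ∧
    (M.IsClassical → (∀ j, 0 < M.capacity j) →
      (∀ i, ContinuousOn (M.utility i) {z | ∀ j, 0 ≤ z j}) →
      (∀ i z, (∀ j, 0 ≤ z j) → 0 ≤ M.utility i z) → M.ConvergesToEquilibrium p q) := by
  obtain ⟨hn, hlt⟩ := FisherMarket.nonempty_and_lt_of_step hβ hstep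
  have hσ0 : 0 < σ := by linarith
  have hα : 0 < β / ((n : ℝ) + 1) := by positivity
  -- Positivity holds because `β n / (n + 1) < β < 2σ`.
  have hc : 0 < β / ((n : ℝ) + 1) * (1 - β / ((n : ℝ) + 1) * n / (2 * σ)) := by
    refine mul_pos hα (sub_pos.2 ?_)
    rw [div_lt_one (by positivity), div_mul_eq_mul_div, div_lt_iff₀ (by positivity)]
    nlinarith [(Nat.cast_nonneg n : (0 : ℝ) ≤ n)]
  have hdec := fun k => FisherMarket.sufficient_decrease hD hσ hσ0 hn (hrun.isDemand k)
    (hxD (k + 1)) (hxD (k + 2)) (hrun.gradient_step hβ k)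
  have hmain : (∃ pEq, M.IsEquilibriumPrice pEq) → M.ConvergesToEquilibrium p q := by
    intro hEq
    obtain ⟨pS, hpS, hlim, v, hv, hmin, C, hC⟩ := FisherMarket.exists_limit_of_gradient hhom hα hc
      -- The shift skips the arbitrary initial multipliers; the bound `C / (k + 1)` at shifted index
      -- `k` is then `C / k` at the original one.
      (p := fun k => p (k + 1)) (x := fun k => x (k + 2)) hrun.isDemand
      (hrun.gradient_step hβ) hdec hEq
    refine ⟨pS, hpS, (tendsto_add_atTop_iff_nat 1).1 hlim, v, hv, hmin, C, fun k hk => ?_⟩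
    obtain ⟨k, rfl⟩ := Nat.exists_eq_add_of_le' hk
    rw [hrun.price_eq, FisherMarket.dual_eq_priceLagrangian (hrun.isDemand k)]
    have := hC k
    exact EReal.coe_le_coe_iff.2 (by push_cast; exact this)
  exact ⟨hmain, fun hcl hs hcont _ => hmain
    (FisherMarket.exists_equilibrium_of_sufficient_decrease hhom hcl hs hcont hc
      (p := fun k => p (k + 1)) (x := fun k => x (k + 2)) hrun.isDemand
      (fun k => hpos (k + 1)) hdec)⟩
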